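/- Let $\ell$ be a prime, $r\ge 1$ and $N\ge 0$ integers, $\Lambda=W(\mathbb{F}_{\ell^r})$ the ring of Witt vectors with its $\ell$-adic topology, and $R=\Lambda[[x_1,\dots,x_N]]$ with its $(\ell,x_1,\dots,x_N)$-adic topology. Let $\mathbb{C}_\ell$ be the completion of an algebraic closure of $\mathbb{Q}_\ell$, with $|\ell|=1/\ell$, and $\mathscr{O}_{\mathbb{C}_\ell}$ its ring of integers. A point of $U(R)$ is a continuous ring homomorphism $z:R\to\mathbb{C}_\ell$. For real $c>0$ let $U_c(R)\subset U(R)$ be the set of points $z$ with $|z(x_i)|\le \ell^{-c}$ for all $i$. For an ideal $I\subset \mathscr{O}_{\mathbb{C}_\ell}[[x_1,\dots,x_N]]$ let $V(I)\subset U(R)$ be the set of points $z$ such that $f(z(x_1),\dots,z(x_N))=0$ for all $f\in I$ (these series converge). A continuous ring automorphism $\varphi$ of $R$ acts on points by $\varphi(z)=z\circ\varphi$. A set $A\subset\mathbb{Z}_{\ge 0}$ is semilinear with period $M\geq 1$ if $A=S\cup\{a+jM\mid a\in T,\ j\in\mathbb{Z}_{\ge 0}\}$ for some finite set $S\subset\mathbb{Z}_{\ge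 0}$ and some $T\subset\{0,1,\dots,M-1\}$. Let $c$ be a real number with $0<c<1$. Then there is an integer $M=M(c,\ell^r,N)\ge 1$, depending only on $c$, $\ell^r$ and $N$, such that for every continuous ring automorphism $\varphi$ of $R$, every $z\in U_c(R)$ and every ideal $I\subset\mathscr{O}_{\mathbb{C}_\ell}[[x_1,\dots,x_N]]$, the set $$\{m\in\mathbb{Z}_{\ge 0}\mid \varphi^m(z)\in V(I)\}$$ is semilinear with period $M$. -/

import Mathlib

open scoped MvPowerSeries.WithPiTopology

namespace LocalMordellLang

/-- `Λ = W(𝔽_{ℓ^r})`, the ring of `ℓ`-typical Witt vectors of the field with `ℓ^r` elements. -/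
abbrev Lam (ℓ : ℕ) [Fact ℓ.Prime] (r : ℕ) : Type := WittVector ℓ (GaloisField ℓ r)

/-- The `ℓ`-adic topology on `Λ`, i.e. the topology of the absolute value with `|ℓ| = 1/ℓ`. -/
noncomputable instance instTopologicalSpaceLam (ℓ : ℕ) [Fact ℓ.Prime] (r : ℕ) : TopologicalSpace (Lam ℓ r) :=
  (Ideal.span {(ℓ : Lam ℓ r)}).adicTopology

/-- `R = Λ[[x_1, …, x_N]]`. Its topology is that of coefficientwise `ℓ`-adic convergence; since
`N` is finite this is the adic topology of the maximal ideal `(ℓ, x_1, …, x_N)`. -/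
abbrev PowerSeriesRing (ℓ : ℕ) [Fact ℓ.Prime] (r N : ℕ) : Type :=
  MvPowerSeries (Fin N) (Lam ℓ r)

/-- A `ℂ_ℓ`-point of the rigid generic fibre `U(R)` of `R = Λ[[x_1, …, x_N]]`: a continuous ring
homomorphism `R → ℂ_ℓ`. Points over finite extensions of `ℚ_ℓ` inside `ℂ_ℓ` are among these. -/
structure Point (ℓ : ℕ) [Fact ℓ.Prime] (r N : ℕ) where
  /-- the underlying ring homomorphism -/
  hom : PowerSeriesRing ℓ r N →+* ℂ_[ℓ]
  continuous_hom : Continuous hom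

section

variable {ℓ : ℕ} [Fact ℓ.Prime] {r N : ℕ}

/-- The `i`-th coordinate `z(x_i)` of the point `z`. -/
noncomputable def Point.coord (z : Point ℓ r N) (i : Fin N) : ℂ_[ℓ] :=
  z.hom (MvPowerSeries.X i)

variable (ℓ r N) in
/-- The closed ball `U_c(R)` of radius `ℓ^{-c}`: the points `z` with `|z(x_i)| ≤ ℓ^{-c}` for
all `i`. -/
def closedBall (c : ℝ) : Set (Point ℓ r N) :=
  {z | ∀ i, ‖z.coord i‖ ≤ (ℓ : ℝ) ^ (-c)}

/-- The point `z` kills the power series `f` over the ring of integers of `ℂ_ℓ`: the series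
`f(z(x_1), …, z(x_N))` sums to `0`. (It always converges, as `|z(x_i)| < 1`.) -/
def Point.Kills (z : Point ℓ r N) (f : MvPowerSeries (Fin N) 𝓞_ℂ_[ℓ]) : Prop :=
  HasSum (fun d : Fin N →₀ ℕ => ((MvPowerSeries.coeff d f : 𝓞_ℂ_[ℓ]) : ℂ_[ℓ]) * ∏ i, z.coord i ^ d i) 0

variable (r) in
/-- The closed analytic subset `V(I) = {z | z(I) = {0}}` of `U(R)`. -/
def vanishingLocus (I : Ideal (MvPowerSeries (Fin N) 𝓞_ℂ_[ℓ])) : Set (Point ℓ r N) :=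
  {z | ∀ f ∈ I, z.Kills f}

/-- The self-map `z ↦ φ(z) = z ∘ φ` of `U(R)` induced by a continuous automorphism `φ` of `R`. -/
noncomputable def Point.map (φ : PowerSeriesRing ℓ r N ≃+* PowerSeriesRing ℓ r N) (hφ : Continuous φ)
    (z : Point ℓ r N) : Point ℓ r N where
  hom := z.hom.comp (φ : PowerSeriesRing ℓ r N →+* PowerSeriesRing ℓ r N)
  continuous_hom := z.continuous_hom.comp hφ

end

/-- `A ⊆ ℤ_{≥ 0}` is semilinear with period `M`: it is the union of a finite set `S` and of the
classes `{a + jM | j ≥ 0}` with `a` in a set `T ⊆ {0, …, M - 1}`. -/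
def IsSemilinearWithPeriod (M : ℕ) (A : Set ℕ) : Prop :=
  ∃ S T : Finset ℕ, (∀ a ∈ T, a < M) ∧ A = {m | m ∈ S ∨ ∃ a ∈ T, ∃ j : ℕ, m = a + j * M}

end LocalMordellLang

/-! Choose `k ≥ 1/c` and give `ℓ` weight `k` and each variable weight `1`. With `ρ = ℓ^(-1/k) ≥
ℓ^(-c)`, a point of the ball sends an element of weight `n` to norm at most `ρ^n` (`norm_hom_le`). A
continuous automorphism preserves the weight filtration, and its quotients are finite. So a power `ψ
= φ^M`, with `M` depending only on the finite quotient, is the identity modulo weight `1 + 2k`, and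
`ψ - 1` then raises all weights by `2k` (`map_sub_mem_weightIdeal`).

Expanding `ψ^n = (1 + (ψ - 1))^n`, the value of `f` at the `n`-th `ψ`-iterate of `z` is a Newton
series `∑ (n choose j) b_j` with `|b_j| ≤ ρ^(2kj) = ℓ^(-2j)`. Since `|j!| ≥ ℓ^(-j)`, `b_j / j! → 0`,
and a Strassmann argument (`finite_or_eq_univ_setOf_newton_eq_zero`) gives finitely many zeros or
identical vanishing. Applying this to each residue class modulo `M` gives semilinearity. -/

namespace LocalMordellLang

/-! ### Zeros of Newton series -/

open Polynomial in
/-- A weak form of Strassmann's theorem for Newton series. -/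
theorem card_le_of_sum_descPochhammer_eq_zero {K : Type*} [NormedField K] [IsUltrametricDist K]
    [CharZero K] (β : ℕ → K) (J : ℕ) (hJ : ∀ j, J < j → ‖β j‖ < ‖β J‖) (s : Finset ℕ) (B : ℕ)
    (hs : ∀ n ∈ s, ∑ j ∈ Finset.range B, β j * (descPochhammer ℤ j).eval (n : ℤ) = 0)
    (hB : J < B) : s.card ≤ J := by
  by_contra! hcard
  obtain ⟨u, hus, hu⟩ := Finset.exists_subset_card_eq (show J + 1 ≤ s.card from hcard)
  -- `W` is monic over `ℤ`, so remainders of falling factorials modulo `W` have integer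
  -- coefficients, of norm at most `1`.
  set W : ℤ[X] := ∏ n ∈ u, (X - C (n : ℤ)) with hW
  have hWm : W.Monic := monic_prod_of_monic _ _ fun n _ => monic_X_sub_C _
  have hWd : W.natDegree = J + 1 := by
    rw [hW, natDegree_prod_of_monic _ _ fun n _ => monic_X_sub_C _]
    simp only [natDegree_X_sub_C]
    simp [hu]
  let ι := Int.castRingHom K
  set G : K[X] := ∑ j ∈ Finset.range B, C (β j) * (descPochhammer ℤ j).map ι with hG
  have hdvd : W.map ι ∣ G := by
    rw [hW, Polynomial.map_prod]
    apply Finset.prod_dvd_of_coprime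
    · intro a _ b _ hab
      simp only [Function.onFun, Polynomial.map_sub, map_X, map_C]
      apply isCoprime_X_sub_C_of_isUnit_sub
      simp only [ι, eq_intCast, Int.cast_natCast, isUnit_iff_ne_zero, ne_eq, sub_eq_zero]
      exact_mod_cast hab
    · intro n hn
      simp only [Polynomial.map_sub, map_X, map_C, dvd_iff_isRoot, IsRoot.def]
      rw [hG, eval_finsetSum, ← hs n (hus hn)]
      refine Finset.sum_congr rfl fun j _ => ?_
      rw [eval_mul, eval_C, eval_map, eval₂_at_apply, eq_intCast]
  have hmod : G %ₘ (W.map ι) = 0 := (modByMonic_eq_zero_iff_dvd (hWm.map ι)).2 hdvd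
  have hlin : G %ₘ (W.map ι) =
      ∑ j ∈ Finset.range B, C (β j) * ((descPochhammer ℤ j) %ₘ W).map ι := by
    rw [← modByMonicHom_apply, hG, map_sum]
    refine Finset.sum_congr rfl fun j _ => ?_
    rw [← smul_eq_C_mul, map_smul, modByMonicHom_apply, ← map_modByMonic ι hWm, smul_eq_C_mul]
  have hcoeff : ∑ j ∈ Finset.range B, β j * (((descPochhammer ℤ j) %ₘ W).coeff J : K) = 0 := by
    have := congrArg (fun p : K[X] => p.coeff J) (hlin.symm.trans hmod)
    simpa [finsetSum_coeff, ι] using this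
  have hsmall : ∀ j ≤ J, (descPochhammer ℤ j) %ₘ W = descPochhammer ℤ j := fun j hj => by
    rw [modByMonic_eq_self_iff hWm]
    apply degree_lt_degree
    rw [hWd, descPochhammer_natDegree]
    omega
  -- In the `X^J` coefficient of the remainder, indices below `J` contribute nothing and those above
  -- have strictly smaller `β j`, so `β J` cannot be cancelled.
  have hmain : ‖∑ j ∈ (Finset.range B).erase J,
      β j * (((descPochhammer ℤ j) %ₘ W).coeff J : K)‖ < ‖β J‖ := by
    rcases ((Finset.range B).erase J).eq_empty_or_nonempty with he | hne
    · by_contra! hle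
      rw [he, Finset.sum_empty, norm_zero] at hle
      exact (norm_nonneg (β (J + 1))).not_gt ((hJ _ (by omega)).trans_le hle)
    · obtain ⟨i, hi, hle⟩ := IsUltrametricDist.exists_norm_finsetSum_le_of_nonempty hne
        fun j => β j * (((descPochhammer ℤ j) %ₘ W).coeff J : K)
      refine hle.trans_lt ?_
      rcases lt_or_gt_of_ne (Finset.ne_of_mem_erase hi) with h | h
      · have hz : (descPochhammer ℤ i).coeff J = 0 :=
          coeff_eq_zero_of_natDegree_lt (by rwa [descPochhammer_natDegree])
        rw [hsmall i h.le, hz]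
        simpa using (norm_nonneg (β (J + 1))).trans_lt (hJ _ (by omega))
      · rw [norm_mul]
        refine lt_of_le_of_lt ?_ (hJ i h)
        exact mul_le_of_le_one_right (norm_nonneg _) (IsUltrametricDist.norm_intCast_le_one K _)
  rw [← Finset.add_sum_erase _ _ (Finset.mem_range.2 hB), hsmall J le_rfl] at hcoeff
  have h1 : (descPochhammer ℤ J).coeff J = 1 := by
    have := monic_descPochhammer ℤ J
    rwa [Monic, leadingCoeff, descPochhammer_natDegree] at this
  rw [h1, Int.cast_one, mul_one, add_eq_zero_iff_eq_neg] at hcoeff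
  rw [hcoeff, norm_neg] at hmain
  exact lt_irrefl _ hmain

/-- A Newton series `∑ b_j (n choose j)` with `b_j / j! → 0` vanishes at finitely many natural
numbers or at all of them. -/
theorem finite_or_eq_univ_setOf_newton_eq_zero {K : Type*} [NormedField K] [IsUltrametricDist K]
    [CharZero K] (b : ℕ → K)
    (hb : Filter.Tendsto (fun j => b j / (j.factorial : K)) Filter.atTop (nhds 0)) :
    {n : ℕ | ∑ j ∈ Finset.range (n + 1), (n.choose j : K) * b j = 0}.Finite ∨
      {n : ℕ | ∑ j ∈ Finset.range (n + 1), (n.choose j : K) * b j = 0} = Set.univ := by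
  by_cases h0 : ∀ j, b j = 0
  · right
    ext n
    simp [h0]
  left
  push Not at h0
  obtain ⟨j₀, hj₀⟩ := h0
  set β : ℕ → K := fun j => b j / (j.factorial : K) with hβ
  have hfin : ∀ j₁, β j₁ ≠ 0 → {j | ‖β j₁‖ ≤ ‖β j‖}.Finite := fun j₁ h => by
    have := (tendsto_zero_iff_norm_tendsto_zero.1 hb).eventually (gt_mem_nhds (norm_pos_iff.2 h))
    rw [← Nat.cofinite_eq_atTop, Filter.eventually_cofinite] at this
    simpa using this
  have hβ₀ : β j₀ ≠ 0 := div_ne_zero hj₀ (by exact_mod_cast j₀.factorial_ne_zero)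
  obtain ⟨j₁, hj₁, hmax⟩ := Set.exists_max_image _ (fun j => ‖β j‖) (hfin j₀ hβ₀)
    ⟨j₀, le_refl (‖β j₀‖)⟩
  have hβ₁ : β j₁ ≠ 0 := norm_pos_iff.1 ((norm_pos_iff.2 hβ₀).trans_le hj₁)
  -- The last index at which the maximal norm is attained.
  obtain ⟨J, hJ, hJmax⟩ := Set.exists_max_image _ id (hfin j₁ hβ₁) ⟨j₁, le_refl (‖β j₁‖)⟩
  have hlast : ∀ j, J < j → ‖β j‖ < ‖β J‖ := fun j hj => by
    by_contra! h
    exact hj.not_ge (hJmax j (le_trans hJ h))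
  by_contra hinf
  obtain ⟨s, hs, hcard⟩ := Set.Infinite.exists_subset_card_eq hinf (J + 1)
  -- One truncation serves all `n ∈ s`: the terms with `j > n` vanish.
  have hle := card_le_of_sum_descPochhammer_eq_zero β J hlast s (J + 1 + s.sup id) ?_ (by omega)
  · omega
  intro n hn
  have hz : ∑ j ∈ Finset.range (n + 1), (n.choose j : K) * b j = 0 := hs hn
  have hnB : n ≤ s.sup id := Finset.le_sup (f := id) hn
  rw [← hz]
  symm
  have hterm : ∀ j, (n.choose j : K) * b j = β j * (descPochhammer ℤ j).eval (n : ℤ) := fun j => by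
    have hf : (j.factorial : K) ≠ 0 := by exact_mod_cast j.factorial_ne_zero
    rw [descPochhammer_eval_eq_descFactorial, Nat.descFactorial_eq_factorial_mul_choose, hβ]
    push_cast
    field_simp
  refine (Finset.sum_congr rfl fun j _ => hterm j).trans
    (Finset.sum_subset (Finset.range_subset_range.2 (by omega)) fun j _ hj => ?_)
  rw [← hterm, Nat.choose_eq_zero_of_lt (by simpa using hj)]
  simp

end LocalMordellLang

/-! ### The weight filtration -/

namespace LocalMordellLang

open MvPowerSeries

section WeightIdeal

variable {σ A : Type*} [CommRing A]

/-- `(n - |d|) ⌈/⌉ k` is the least `e` with `k * e + |d| ≥ n`; weights add because this exponent is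
subadditive. -/
theorem pow_ceilDiv_dvd_coeff_mul (p : A) {k : ℕ} (hk : 0 < k) {m n : ℕ} {f g : MvPowerSeries σ A}
    (hf : ∀ d, p ^ ((m - d.degree) ⌈/⌉ k) ∣ coeff d f)
    (hg : ∀ d, p ^ ((n - d.degree) ⌈/⌉ k) ∣ coeff d g) (d : σ →₀ ℕ) :
    p ^ ((m + n - d.degree) ⌈/⌉ k) ∣ coeff d (f * g) := by
  classical
  rw [coeff_mul]
  refine Finset.dvd_sum fun x hx => ?_
  refine dvd_trans (pow_dvd_pow p ?_) ((pow_add p _ _).dvd.trans (mul_dvd_mul (hf x.1) (hg x.2)))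
  have hd : x.1.degree + x.2.degree = d.degree := by
    rw [← map_add, Finset.HasAntidiagonal.mem_antidiagonal.1 hx]
  rw [ceilDiv_le_iff_le_mul hk, mul_add]
  have h1 := le_smul_ceilDiv (b := m - x.1.degree) hk
  have h2 := le_smul_ceilDiv (b := n - x.2.degree) hk
  rw [smul_eq_mul] at h1 h2
  omega

/-- The ideal of power series all of whose terms have weight at least `n`, where `p` has
weight `k` and the variables have weight `1`. -/
def weightIdeal (σ : Type*) {A : Type*} [CommRing A] (p : A) (k : ℕ) [NeZero k] (n : ℕ) :
    Ideal (MvPowerSeries σ A) where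
  carrier := {f | ∀ d, p ^ ((n - d.degree) ⌈/⌉ k) ∣ coeff d f}
  add_mem' hf hg d := by
    rw [map_add]
    exact dvd_add (hf d) (hg d)
  zero_mem' d := by simp
  smul_mem' f g hg d := by
    have := pow_ceilDiv_dvd_coeff_mul p (NeZero.pos k) (m := 0) (f := f) (by simp) hg d
    rwa [zero_add] at this

variable {p : A} {k : ℕ} [NeZero k] {m n : ℕ}

theorem mem_weightIdeal {f : MvPowerSeries σ A} :
    f ∈ weightIdeal σ p k n ↔ ∀ d, p ^ ((n - d.degree) ⌈/⌉ k) ∣ coeff d f :=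
  Iff.rfl

theorem mul_mem_weightIdeal {f g : MvPowerSeries σ A} (hf : f ∈ weightIdeal σ p k m)
    (hg : g ∈ weightIdeal σ p k n) : f * g ∈ weightIdeal σ p k (m + n) :=
  pow_ceilDiv_dvd_coeff_mul p (NeZero.pos k) hf hg

theorem weightIdeal_anti (h : m ≤ n) : weightIdeal σ p k n ≤ weightIdeal σ p k m :=
  fun _ hf d => (pow_dvd_pow p (by
    rw [ceilDiv_le_iff_le_mul (NeZero.pos k)]
    have := le_smul_ceilDiv (b := n - d.degree) (NeZero.pos k)
    rw [smul_eq_mul] at this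
    omega)).trans (hf d)

theorem mem_weightIdeal_zero (f : MvPowerSeries σ A) : f ∈ weightIdeal σ p k 0 := by
  simp [mem_weightIdeal]

theorem monomial_mem_weightIdeal {d : σ →₀ ℕ} {e : ℕ} {a : A} (ha : p ^ e ∣ a)
    (hn : n ≤ k * e + d.degree) : monomial d a ∈ weightIdeal σ p k n := by
  classical
  intro d'
  rw [coeff_monomial]
  split_ifs with h
  · refine (pow_dvd_pow p ?_).trans ha
    rw [ceilDiv_le_iff_le_mul (NeZero.pos k), h]
    omega
  · exact dvd_zero _

theorem X_mem_weightIdeal (i : σ) : (X i : MvPowerSeries σ A) ∈ weightIdeal σ p k 1 :=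
  monomial_mem_weightIdeal (e := 0) (by simp) (by simp)

theorem pow_C_mem_weightIdeal (e : ℕ) :
    (C p ^ e : MvPowerSeries σ A) ∈ weightIdeal σ p k (k * e) := by
  rw [← map_pow]
  exact monomial_mem_weightIdeal (d := 0) dvd_rfl (by simp)

theorem mem_weightIdeal_one {f : MvPowerSeries σ A} (hf : p ∣ constantCoeff f) :
    f ∈ weightIdeal σ p k 1 := by
  intro d
  by_cases hd : d = 0
  · subst hd
    refine dvd_trans ?_ hf
    conv_rhs => rw [← pow_one p]
    refine pow_dvd_pow p ?_
    rw [ceilDiv_le_iff_le_mul (NeZero.pos k)]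
    have := NeZero.pos k
    simp
    omega
  · have : 1 - d.degree = 0 := by
      have : d.degree ≠ 0 := fun h => hd ((Finsupp.degree_eq_zero_iff d).1 h)
      omega
    simp [this]

/-- A crude bound (`k * n ≥ n`) showing that finitely many coefficients modulo `p ^ n` determine the
class modulo weight `n`. -/
theorem mem_weightIdeal_of_forall_pow_dvd {f : MvPowerSeries σ A}
    (hf : ∀ d : σ →₀ ℕ, d.degree ≤ n → p ^ n ∣ coeff d f) : f ∈ weightIdeal σ p k n := by
  intro d
  rcases le_or_gt d.degree n with h | h
  · refine (pow_dvd_pow p ?_).trans (hf d h)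
    rw [ceilDiv_le_iff_le_mul (NeZero.pos k)]
    have := NeZero.pos k
    nlinarith [Nat.sub_le n d.degree]
  · simp [Nat.sub_eq_zero_of_le h.le]

theorem finite_quotient_weightIdeal [Finite σ] (hA : Finite (A ⧸ Ideal.span {p ^ n})) :
    Finite (MvPowerSeries σ A ⧸ weightIdeal σ p k n) := by
  have : Finite {d : σ →₀ ℕ // d.degree ≤ n} := Finsupp.finite_of_degree_le n
  let F : MvPowerSeries σ A → ({d : σ →₀ ℕ // d.degree ≤ n} → A ⧸ Ideal.span {p ^ n}) :=
    fun f d => Ideal.Quotient.mk _ (coeff d.1 f)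
  refine Finite.of_injective
    (fun q : MvPowerSeries σ A ⧸ weightIdeal σ p k n => F q.out) fun a b hab => ?_
  rw [← Quotient.out_eq a, ← Quotient.out_eq b]
  refine (Ideal.Quotient.eq (I := weightIdeal σ p k n)).2
    (mem_weightIdeal_of_forall_pow_dvd fun d hd => ?_)
  rw [map_sub, ← Ideal.mem_span_singleton, ← Ideal.Quotient.eq]
  exact congrFun hab ⟨d, hd⟩

theorem monomial_one_eq_prod_X_pow [Fintype σ] (d : σ →₀ ℕ) :
    (monomial d (1 : A) : MvPowerSeries σ A) = ∏ i, X i ^ d i := by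
  classical
  have h := MvPolynomial.monomial_eq (s := d) (a := (1 : A))
  rw [MvPolynomial.C_1, one_mul, Finsupp.prod_fintype _ _ (by simp)] at h
  have h' := congrArg (fun q : MvPolynomial σ A => (q : MvPowerSeries σ A)) h
  simp only [MvPolynomial.coe_monomial] at h'
  rw [h', ← MvPolynomial.coeToMvPowerSeries.ringHom_apply, map_prod]
  simp

theorem C_mul_monomial_one (d : σ →₀ ℕ) (a : A) :
    C a * monomial d (1 : A) = monomial d a := by
  rw [← monomial_zero_eq_C_apply, monomial_mul_monomial, zero_add, mul_one]

end WeightIdeal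

/-! ### Topology of Witt vectors and their power series -/

section WittVector

variable {ℓ : ℕ} [Fact ℓ.Prime] {r N : ℕ}

instance isTopologicalRing_lam : IsTopologicalRing (Lam ℓ r) :=
  (Ideal.adic_basis (Ideal.span {(ℓ : Lam ℓ r)})).toRing_subgroups_basis.toRingFilterBasis.isTopologicalRing

theorem hasBasis_nhds_zero_lam :
    (nhds (0 : Lam ℓ r)).HasBasis (fun _ : ℕ => True) fun n => {a | (ℓ : Lam ℓ r) ^ n ∣ a} := by
  have := (Ideal.span {(ℓ : Lam ℓ r)}).hasBasis_nhds_zero_adic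
  simp only [Ideal.span_singleton_pow] at this
  convert this using 2 with n
  ext a
  simp [Ideal.mem_span_singleton]

theorem isClosed_setOf_pow_dvd (n : ℕ) : IsClosed {a : Lam ℓ r | (ℓ : Lam ℓ r) ^ n ∣ a} := by
  let S : AddSubgroup (Lam ℓ r) := (Ideal.span {(ℓ : Lam ℓ r) ^ n}).toAddSubgroup
  have hS : {a : Lam ℓ r | (ℓ : Lam ℓ r) ^ n ∣ a} = S := by
    ext a
    exact Ideal.mem_span_singleton.symm
  rw [hS]
  refine S.isClosed_of_isOpen (S.isOpen_of_mem_nhds (g := 0) ?_)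
  rw [← hS]
  exact hasBasis_nhds_zero_lam.mem_of_mem trivial

theorem finite_quotient_span_pow (n : ℕ) :
    Finite (Lam ℓ r ⧸ Ideal.span {(ℓ : Lam ℓ r) ^ n}) := by
  have : Finite (TruncatedWittVector ℓ n (GaloisField ℓ r)) :=
    inferInstanceAs (Finite (Fin n → GaloisField ℓ r))
  refine Finite.of_injective (fun q : Lam ℓ r ⧸ Ideal.span {(ℓ : Lam ℓ r) ^ n} =>
    (WittVector.truncate n q.out : TruncatedWittVector ℓ n (GaloisField ℓ r))) fun a b hab => ?_
  rw [← Quotient.out_eq a, ← Quotient.out_eq b]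
  refine (Ideal.Quotient.eq (I := Ideal.span {(ℓ : Lam ℓ r) ^ n})).2 ?_
  rw [WittVector.mem_span_p_pow_iff_le_coeff_eq_zero, ← WittVector.mem_ker_truncate,
    RingHom.mem_ker, map_sub, sub_eq_zero]
  exact hab

theorem dvd_constantCoeff_of_not_isUnit {f : PowerSeriesRing ℓ r N} (hf : ¬ IsUnit f) :
    (ℓ : Lam ℓ r) ∣ constantCoeff f := by
  rw [isUnit_iff_constantCoeff] at hf
  rw [← Ideal.mem_span_singleton, WittVector.mem_span_p_iff_coeff_zero_eq_zero]
  by_contra h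
  exact hf (WittVector.isUnit_of_coeff_zero_ne_zero _ h)

theorem isClosed_weightIdeal (k : ℕ) [NeZero k] (n : ℕ) :
    IsClosed (weightIdeal (Fin N) (ℓ : Lam ℓ r) k n : Set (PowerSeriesRing ℓ r N)) := by
  have : (weightIdeal (Fin N) (ℓ : Lam ℓ r) k n : Set (PowerSeriesRing ℓ r N)) =
      ⋂ d, coeff d ⁻¹' {a | (ℓ : Lam ℓ r) ^ ((n - d.degree) ⌈/⌉ k) ∣ a} := by
    ext f
    simp [mem_weightIdeal]
  rw [this]
  exact isClosed_iInter fun d =>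
    (isClosed_setOf_pow_dvd _).preimage (WithPiTopology.continuous_coeff _ d)

/-- A power series is the convergent sum of its monomials, so closed conditions need only be checked
on these. -/
theorem map_mem_of_forall_monomial {G : Type*} [AddCommGroup G] [TopologicalSpace G]
    (D : PowerSeriesRing ℓ r N →+ G) (hD : Continuous D) (S : AddSubgroup G)
    (hS : IsClosed (S : Set G)) (f : PowerSeriesRing ℓ r N)
    (h : ∀ d, D (monomial d (coeff d f)) ∈ S) : D f ∈ S := by
  have hsum := (WithPiTopology.hasSum_of_monomials_self f).map D hD
  exact hS.mem_of_tendsto hsum (Filter.Eventually.of_forall fun t => sum_mem fun d _ => h d)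

end WittVector

end LocalMordellLang

/-! ### Automorphisms and the weight filtration -/

namespace LocalMordellLang

open MvPowerSeries

variable {ℓ : ℕ} [Fact ℓ.Prime] {r N : ℕ} {k : ℕ} [NeZero k]

/-- If a ring endomorphism moves the constants by weight `s`, and the variables by weight `1 + s`,
then it moves every element of weight `n` by weight `n + s`. -/
theorem map_sub_mem_weightIdeal (ψ : PowerSeriesRing ℓ r N →+* PowerSeriesRing ℓ r N)
    (hψ : Continuous ψ) (s : ℕ)
    (hC : ∀ a, ψ (C a) - C a ∈ weightIdeal (Fin N) (ℓ : Lam ℓ r) k s)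
    (hX : ∀ i, ψ (X i) - X i ∈ weightIdeal (Fin N) (ℓ : Lam ℓ r) k (1 + s)) {n : ℕ}
    {f : PowerSeriesRing ℓ r N} (hf : f ∈ weightIdeal (Fin N) (ℓ : Lam ℓ r) k n) :
    ψ f - f ∈ weightIdeal (Fin N) (ℓ : Lam ℓ r) k (n + s) := by
  let J := weightIdeal (Fin N) (ℓ : Lam ℓ r) k
  -- `P` is multiplicative, by the twisted Leibniz rule for `ψ - 1`, so it suffices to treat `ℓ`,
  -- constants and variables.
  let P : ℕ → PowerSeriesRing ℓ r N → Prop := fun a x => x ∈ J a ∧ ψ x - x ∈ J (a + s)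
  have hmul : ∀ {a b x y}, P a x → P b y → P (a + b) (x * y) := by
    rintro a b x y ⟨hx, hx'⟩ ⟨hy, hy'⟩
    refine ⟨mul_mem_weightIdeal hx hy, ?_⟩
    have hψx : ψ x ∈ J a := by
      have := add_mem (weightIdeal_anti (Nat.le_add_right a s) hx') hx
      rwa [sub_add_cancel] at this
    have h1 : ψ (x * y) - x * y = ψ x * (ψ y - y) + (ψ x - x) * y := by
      rw [map_mul]
      ring
    rw [h1]
    refine add_mem ?_ ?_
    · rw [add_assoc]
      exact mul_mem_weightIdeal hψx hy'
    · rw [add_right_comm]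
      exact mul_mem_weightIdeal hx' hy
  have hone : P 0 1 := ⟨mem_weightIdeal_zero _, by simp⟩
  have hpow : ∀ {a x} (e : ℕ), P a x → P (a * e) (x ^ e) := by
    intro a x e hx
    induction e with
    | zero => simpa using hone
    | succ e ih => simpa only [pow_succ, Nat.mul_succ] using hmul ih hx
  have hprod : ∀ (d : Fin N →₀ ℕ) (u : Finset (Fin N)),
      P (∑ i ∈ u, d i) (∏ i ∈ u, (X i : PowerSeriesRing ℓ r N) ^ d i) := by
    intro d u
    induction u using Finset.induction_on with
    | empty => simpa using hone
    | insert i u hi ih =>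
      rw [Finset.sum_insert hi, Finset.prod_insert hi]
      have h := hpow (d i) ⟨X_mem_weightIdeal (p := (ℓ : Lam ℓ r)) (k := k) i, hX i⟩
      rw [one_mul] at h
      exact hmul h ih
  have hp : P k (C (ℓ : Lam ℓ r)) := by
    refine ⟨by simpa using pow_C_mem_weightIdeal (σ := Fin N) (p := (ℓ : Lam ℓ r)) (k := k) 1, ?_⟩
    rw [map_natCast, map_natCast, sub_self]
    exact zero_mem _
  let D : PowerSeriesRing ℓ r N →+ PowerSeriesRing ℓ r N :=
    ψ.toAddMonoidHom - AddMonoidHom.id (PowerSeriesRing ℓ r N)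
  have hmono : ∀ d, D (monomial d (coeff d f)) ∈
      (J (n + s)).toAddSubgroup := by
    intro d
    obtain ⟨u, hu⟩ := hf d
    have hdeg : ∑ i, d i = d.degree := (Finsupp.degree_eq_sum d).symm
    have h := hmul (hmul (hpow ((n - d.degree) ⌈/⌉ k) hp)
      ⟨mem_weightIdeal_zero (C u), by simpa using hC u⟩) (hprod d Finset.univ)
    rw [hdeg, ← monomial_one_eq_prod_X_pow, ← map_pow, ← map_mul, ← hu, C_mul_monomial_one] at h
    refine weightIdeal_anti ?_ h.2
    have := le_smul_ceilDiv (b := n - d.degree) (NeZero.pos k)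
    rw [smul_eq_mul] at this
    omega
  exact map_mem_of_forall_monomial D (hψ.sub continuous_id) (J (n + s)).toAddSubgroup
    (isClosed_weightIdeal k _) f hmono

theorem not_isUnit_X (i : Fin N) : ¬ IsUnit (X i : PowerSeriesRing ℓ r N) := by
  rw [isUnit_iff_constantCoeff]
  simp

/-- Automorphisms preserve non-units, and a non-unit has constant term divisible by `ℓ`. -/
theorem map_X_mem_weightIdeal_one (φ : PowerSeriesRing ℓ r N ≃+* PowerSeriesRing ℓ r N)
    (i : Fin N) : φ (X i) ∈ weightIdeal (Fin N) (ℓ : Lam ℓ r) k 1 :=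
  mem_weightIdeal_one (dvd_constantCoeff_of_not_isUnit fun h =>
    not_isUnit_X i ((MulEquiv.isUnit_map φ).1 h))

theorem map_mem_weightIdeal (φ : PowerSeriesRing ℓ r N ≃+* PowerSeriesRing ℓ r N)
    (hφ : Continuous φ) {n : ℕ} {f : PowerSeriesRing ℓ r N}
    (hf : f ∈ weightIdeal (Fin N) (ℓ : Lam ℓ r) k n) :
    φ f ∈ weightIdeal (Fin N) (ℓ : Lam ℓ r) k n := by
  have h := map_sub_mem_weightIdeal (k := k) φ.toRingHom hφ 0 (fun a => mem_weightIdeal_zero _)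
    (fun i => sub_mem (map_X_mem_weightIdeal_one φ i) (X_mem_weightIdeal i)) hf
  have := add_mem h hf
  rwa [sub_add_cancel] at this

variable (ℓ r N k) in
/-- An exponent `M` such that `φ ^ M` is the identity modulo weight `t`, for every continuous
automorphism `φ`. -/
noncomputable def automorphismExponent (t : ℕ) : ℕ :=
  Nat.card (Equiv.Perm (PowerSeriesRing ℓ r N ⧸ weightIdeal (Fin N) (ℓ : Lam ℓ r) k t))

instance finite_quotient_weightIdeal_lam (t : ℕ) :
    Finite (PowerSeriesRing ℓ r N ⧸ weightIdeal (Fin N) (ℓ : Lam ℓ r) k t) :=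
  finite_quotient_weightIdeal (finite_quotient_span_pow t)

theorem automorphismExponent_pos (t : ℕ) : 0 < automorphismExponent ℓ r N k t :=
  Nat.card_pos

theorem iterate_automorphismExponent_sub_mem
    (φ : PowerSeriesRing ℓ r N ≃+* PowerSeriesRing ℓ r N) (hφ : Continuous φ) (t : ℕ)
    (f : PowerSeriesRing ℓ r N) :
    φ^[automorphismExponent ℓ r N k t] f - f ∈ weightIdeal (Fin N) (ℓ : Lam ℓ r) k t := by
  let J := weightIdeal (Fin N) (ℓ : Lam ℓ r) k t
  let φ' : PowerSeriesRing ℓ r N ⧸ J →+* PowerSeriesRing ℓ r N ⧸ J :=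
    Ideal.quotientMap J φ.toRingHom fun _ h => map_mem_weightIdeal φ hφ h
  have hmk : ∀ g, φ' (Ideal.Quotient.mk J g) = Ideal.Quotient.mk J (φ g) := fun g =>
    Ideal.quotientMap_mk
  have hsurj : Function.Surjective φ' := fun q => by
    obtain ⟨g, rfl⟩ := Ideal.Quotient.mk_surjective q
    exact ⟨Ideal.Quotient.mk J (φ.symm g), by rw [hmk, φ.apply_symm_apply]⟩
  let e : Equiv.Perm (PowerSeriesRing ℓ r N ⧸ J) :=
    Equiv.ofBijective φ' (Finite.injective_iff_surjective.2 hsurj |>.bijective_of_finite)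
  have hiter : ∀ m : ℕ, (e ^ m) (Ideal.Quotient.mk J f) = Ideal.Quotient.mk J (φ^[m] f) := by
    intro m
    induction m with
    | zero => rfl
    | succ m ih =>
      rw [pow_succ', Equiv.Perm.mul_apply, ih, Function.iterate_succ_apply']
      exact hmk _
  -- The order of the full permutation group kills every permutation, whence an exponent independent
  -- of `φ`.
  rw [← Ideal.Quotient.eq, ← hiter, automorphismExponent, pow_card_eq_one', Equiv.Perm.one_apply]

/-- The binomial expansion of the iterates of `ψ` in terms of `ψ - 1`. -/
theorem iterate_eq_sum_choose {G : Type*} [AddCommGroup G] (ψ : AddMonoid.End G) (n : ℕ) (x : G) :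
    ψ^[n] x = ∑ j ∈ Finset.range (n + 1), n.choose j • (⇑(ψ - 1 : AddMonoid.End G))^[j] x := by
  have h : ψ ^ n = ∑ j ∈ Finset.range (n + 1), (ψ - 1) ^ j * (n.choose j : AddMonoid.End G) := by
    conv_lhs => rw [← sub_add_cancel ψ 1]
    rw [(Commute.one_right (ψ - 1)).add_pow]
    simp
  have hx := DFunLike.congr_fun h x
  rw [AddMonoid.End.coe_pow] at hx
  rw [hx]
  refine (AddMonoidHom.finsetSum_apply _ _ _).trans (Finset.sum_congr rfl fun j _ => ?_)
  change ((ψ - 1) ^ j) (n.choose j • x) = _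
  rw [map_nsmul, AddMonoid.End.coe_pow]

end LocalMordellLang

/-! ### Estimates at points and the Newton expansion -/

namespace LocalMordellLang

open MvPowerSeries

variable {ℓ : ℕ} [Fact ℓ.Prime] {r N : ℕ} {k : ℕ} [NeZero k]

theorem norm_natCast_complex (n : ℕ) : ‖(n : ℂ_[ℓ])‖ = ‖(n : ℚ_[ℓ])‖ := by
  rw [← PadicComplex.norm_extends' ℓ (n : ℚ_[ℓ])]
  simp

theorem norm_prime_complex : ‖(ℓ : ℂ_[ℓ])‖ = (ℓ : ℝ)⁻¹ := by
  rw [norm_natCast_complex, Padic.norm_p]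

theorem norm_coe_complexInt_le (x : 𝓞_ℂ_[ℓ]) : ‖(x : ℂ_[ℓ])‖ ≤ 1 := by
  have h : Valued.v (x : ℂ_[ℓ]) ≤ 1 := x.2
  rw [PadicComplex.norm_eq_norm ℓ (x : ℂ_[ℓ])]
  exact Valued.toNormedField.norm_le_one_iff.2 h

/-- Legendre's formula gives `v(j!) ≤ j / (ℓ - 1) ≤ j`, including for `ℓ = 2`. -/
theorem inv_pow_le_norm_factorial (j : ℕ) : ((ℓ : ℝ)⁻¹) ^ j ≤ ‖(j.factorial : ℂ_[ℓ])‖ := by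
  have hℓ := (Fact.out : ℓ.Prime)
  rw [norm_natCast_complex, Padic.norm_eq_zpow_neg_valuation
    (by exact_mod_cast j.factorial_ne_zero), Padic.valuation_natCast, inv_pow, ← zpow_natCast,
    ← zpow_neg]
  refine zpow_le_zpow_right₀ (by exact_mod_cast hℓ.one_le) ?_
  have h := sub_one_mul_padicValNat_factorial (p := ℓ) j
  have h1 : 1 ≤ ℓ - 1 := Nat.le_sub_one_of_lt hℓ.one_lt
  have : padicValNat ℓ j.factorial ≤ j := by nlinarith [Nat.sub_le j (ℓ.digits j).sum]
  omega

/-- Continuity at `0` bounds the image of `Λ`; an element of norm above `1` would have unbounded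
powers. -/
theorem norm_hom_C_le_one (z : Point ℓ r N) (a : Lam ℓ r) : ‖z.hom (C a)‖ ≤ 1 := by
  let τ : Lam ℓ r →+* ℂ_[ℓ] := z.hom.comp C
  have hτ : Continuous τ := z.continuous_hom.comp WithPiTopology.continuous_C
  have hmem : τ ⁻¹' Metric.ball 0 1 ∈ nhds (0 : Lam ℓ r) :=
    hτ.continuousAt.preimage_mem_nhds (by simpa using Metric.ball_mem_nhds (0 : ℂ_[ℓ]) one_pos)
  obtain ⟨n, -, hn⟩ := hasBasis_nhds_zero_lam.mem_iff.1 hmem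
  have hℓ : (0 : ℝ) < ℓ := by exact_mod_cast (Fact.out : ℓ.Prime).pos
  have hbound : ∀ b : Lam ℓ r, ‖τ b‖ ≤ (ℓ : ℝ) ^ n := fun b => by
    have h : ‖τ ((ℓ : Lam ℓ r) ^ n * b)‖ < 1 := by
      simpa using hn (show (ℓ : Lam ℓ r) ^ n ∣ _ from dvd_mul_right _ b)
    rw [map_mul, map_pow, map_natCast, norm_mul, norm_pow, norm_prime_complex, inv_pow] at h
    exact ((inv_mul_lt_iff₀ (by positivity)).1 h).le.trans_eq (mul_one _)
  by_contra! hgt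
  obtain ⟨m, hm⟩ := pow_unbounded_of_one_lt ((ℓ : ℝ) ^ n) hgt
  have := hbound (a ^ m)
  rw [map_pow, norm_pow] at this
  exact this.not_gt hm

theorem norm_hom_le (z : Point ℓ r N) {ρ : ℝ} (hρ0 : 0 < ρ) (hρ1 : ρ ≤ 1)
    (hρ : ρ ^ k = (ℓ : ℝ)⁻¹) (hz : ∀ i, ‖z.coord i‖ ≤ ρ) {n : ℕ} {f : PowerSeriesRing ℓ r N}
    (hf : f ∈ weightIdeal (Fin N) (ℓ : Lam ℓ r) k n) : ‖z.hom f‖ ≤ ρ ^ n := by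
  let S := (IsUltrametricDist.closedBall_openAddSubgroup ℂ_[ℓ]
    (pow_pos hρ0 n)).toAddSubgroup
  have hS : ∀ x, x ∈ S ↔ ‖x‖ ≤ ρ ^ n := fun x => mem_closedBall_zero_iff
  rw [← hS]
  refine map_mem_of_forall_monomial z.hom.toAddMonoidHom z.continuous_hom S
    Metric.isClosed_closedBall f fun d => ?_
  rw [hS]
  obtain ⟨u, hu⟩ := hf d
  have hprod : ‖z.hom (monomial d 1)‖ ≤ ρ ^ d.degree := by
    rw [monomial_one_eq_prod_X_pow, map_prod, norm_prod, Finsupp.degree_eq_sum,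
      ← Finset.prod_pow_eq_pow_sum]
    refine Finset.prod_le_prod (fun i _ => norm_nonneg _) fun i _ => ?_
    rw [map_pow, norm_pow]
    exact pow_le_pow_left₀ (norm_nonneg _) (hz i) _
  have hw := le_smul_ceilDiv (b := n - d.degree) (NeZero.pos k)
  rw [smul_eq_mul] at hw
  have hc : ‖z.hom (C (coeff d f))‖ ≤ ρ ^ (n - d.degree) := by
    rw [hu, map_mul, map_mul, map_pow, map_pow, map_natCast, map_natCast, norm_mul, norm_pow,
      norm_prime_complex, ← hρ, ← pow_mul]
    exact (mul_le_of_le_one_right (by positivity) (norm_hom_C_le_one z u)).trans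
      (pow_le_pow_of_le_one hρ0.le hρ1 hw)
  change ‖z.hom (monomial d (coeff d f))‖ ≤ ρ ^ n
  rw [← C_mul_monomial_one, map_mul, norm_mul]
  calc _ ≤ ρ ^ (n - d.degree) * ρ ^ d.degree :=
        mul_le_mul hc hprod (norm_nonneg _) (by positivity)
    _ = ρ ^ (n - d.degree + d.degree) := (pow_add _ _ _).symm
    _ ≤ ρ ^ n := pow_le_pow_of_le_one hρ0.le hρ1 (by omega)

theorem map_iterate_hom (φ : PowerSeriesRing ℓ r N ≃+* PowerSeriesRing ℓ r N) (hφ : Continuous φ)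
    (m : ℕ) (z : Point ℓ r N) (f : PowerSeriesRing ℓ r N) :
    ((Point.map φ hφ)^[m] z).hom f = z.hom (φ^[m] f) := by
  induction m generalizing z with
  | zero => rfl
  | succ m ih =>
    rw [Function.iterate_succ_apply, ih, Function.iterate_succ_apply']
    rfl

theorem kills_iff_hasSum (z : Point ℓ r N) (f : MvPowerSeries (Fin N) 𝓞_ℂ_[ℓ]) :
    z.Kills f ↔ HasSum (fun d => ((coeff d f : 𝓞_ℂ_[ℓ]) : ℂ_[ℓ]) * z.hom (monomial d 1)) 0 := by
  have : ∀ d : Fin N →₀ ℕ, ∏ i, z.coord i ^ d i = z.hom (monomial d 1) := fun d => by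
    rw [monomial_one_eq_prod_X_pow, map_prod]
    simp only [map_pow]
    rfl
  simp only [Point.Kills, this]

/-- Along the iterates of an automorphism that is sufficiently close to the identity, a power
series vanishes finitely often or always. -/
theorem finite_or_eq_univ_setOf_kills (φ : PowerSeriesRing ℓ r N ≃+* PowerSeriesRing ℓ r N)
    (hφ : Continuous φ) {M : ℕ}
    (hM : ∀ f, φ^[M] f - f ∈ weightIdeal (Fin N) (ℓ : Lam ℓ r) k (1 + 2 * k))
    (z : Point ℓ r N) {ρ : ℝ} (hρ0 : 0 < ρ) (hρ1 : ρ < 1) (hρ : ρ ^ k = (ℓ : ℝ)⁻¹)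
    (hz : ∀ i, ‖z.coord i‖ ≤ ρ) (f : MvPowerSeries (Fin N) 𝓞_ℂ_[ℓ]) :
    {n : ℕ | ((Point.map φ hφ)^[M * n] z).Kills f}.Finite ∨
      {n : ℕ | ((Point.map φ hφ)^[M * n] z).Kills f} = Set.univ := by
  let J := weightIdeal (Fin N) (ℓ : Lam ℓ r) k
  let ψ : PowerSeriesRing ℓ r N →+* PowerSeriesRing ℓ r N := φ.toRingHom ^ M
  have hψφ : ⇑ψ = φ^[M] := RingHom.coe_pow _ _
  have hψ : Continuous ψ := by
    rw [hψφ]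
    exact hφ.iterate M
  -- In `1 + 2 * k`, the `1` is the weight of a variable and `2 * k` the gain.
  have hψJ : ∀ {n x}, x ∈ J n → ψ x - x ∈ J (n + 2 * k) := fun hx =>
    map_sub_mem_weightIdeal ψ hψ (2 * k)
      (fun a => weightIdeal_anti (Nat.le_add_left _ 1) (hψφ ▸ hM (C a))) (fun i => hψφ ▸ hM (X i)) hx
  let Ψ : AddMonoid.End (PowerSeriesRing ℓ r N) := ψ.toAddMonoidHom
  let D : AddMonoid.End (PowerSeriesRing ℓ r N) := Ψ - 1
  have hD : ∀ (j : ℕ) {n x}, x ∈ J n → D^[j] x ∈ J (n + j * (2 * k)) := by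
    intro j
    induction j with
    | zero => intro n x hx; simpa using hx
    | succ j ih =>
      intro n x hx
      rw [Function.iterate_succ_apply', add_one_mul, ← add_assoc]
      exact hψJ (ih hx)
  let T : ℕ → (Fin N →₀ ℕ) → ℂ_[ℓ] := fun j d =>
    ((coeff d f : 𝓞_ℂ_[ℓ]) : ℂ_[ℓ]) * z.hom (D^[j] (monomial d 1))
  have hT : ∀ j d, ‖T j d‖ ≤ ρ ^ (d.degree + j * (2 * k)) := fun j d => by
    rw [norm_mul]
    refine (mul_le_of_le_one_left (norm_nonneg _) (norm_coe_complexInt_le _)).trans ?_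
    exact norm_hom_le z hρ0 hρ1.le hρ hz
      (hD j (monomial_mem_weightIdeal (e := 0) (by simp) (by simp)))
  have hsum : ∀ j, Summable (T j) := fun j => by
    refine NonarchimedeanAddGroup.summable_of_tendsto_cofinite_zero ?_
    rw [tendsto_zero_iff_norm_tendsto_zero]
    have hdeg : Filter.Tendsto (fun d : Fin N →₀ ℕ => d.degree) Filter.cofinite Filter.atTop := by
      rw [Filter.tendsto_atTop]
      intro b
      rw [Filter.eventually_cofinite]
      exact (Finsupp.finite_of_degree_le b).subset fun d hd => (not_le.1 hd).le
    refine squeeze_zero (fun d => norm_nonneg _) (fun d => (hT j d).trans ?_)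
      ((tendsto_pow_atTop_nhds_zero_of_lt_one hρ0.le hρ1).comp hdeg)
    exact pow_le_pow_of_le_one hρ0.le hρ1.le (Nat.le_add_right _ _)
  have hkills : ∀ n, ((Point.map φ hφ)^[M * n] z).Kills f ↔
      ∑ j ∈ Finset.range (n + 1), (n.choose j : ℂ_[ℓ]) * ∑' d, T j d = 0 := by
    intro n
    have h := hasSum_sum (s := Finset.range (n + 1))
      fun j _ => (hsum j).hasSum.mul_left (n.choose j : ℂ_[ℓ])
    have hfun : (fun d => ((coeff d f : 𝓞_ℂ_[ℓ]) : ℂ_[ℓ]) *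
        ((Point.map φ hφ)^[M * n] z).hom (monomial d 1)) =
        fun d => ∑ j ∈ Finset.range (n + 1), (n.choose j : ℂ_[ℓ]) * T j d := by
      funext d
      have hexp := iterate_eq_sum_choose Ψ n (monomial d 1)
      rw [map_iterate_hom, Function.iterate_mul, ← hψφ]
      refine (congrArg (fun y => ((coeff d f : 𝓞_ℂ_[ℓ]) : ℂ_[ℓ]) * z.hom y) hexp).trans ?_
      rw [map_sum, Finset.mul_sum]
      refine Finset.sum_congr rfl fun j _ => ?_
      rw [map_nsmul, nsmul_eq_mul, mul_left_comm]
    rw [kills_iff_hasSum, hfun]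
    exact ⟨fun h0 => h.unique h0, fun h0 => h0 ▸ h⟩
  simp only [hkills]
  refine finite_or_eq_univ_setOf_newton_eq_zero (fun j => ∑' d, T j d) ?_
  have hℓ1 : (1 : ℝ) < ℓ := by exact_mod_cast (Fact.out : ℓ.Prime).one_lt
  refine squeeze_zero_norm (fun j => ?_) (tendsto_pow_atTop_nhds_zero_of_lt_one (r := (ℓ : ℝ)⁻¹)
    (by positivity) (inv_lt_one_of_one_lt₀ hℓ1))
  rw [norm_div]
  -- One factor absorbs `1 / j!`; the other tends to `0`.
  have hb : ‖∑' d, T j d‖ ≤ ((ℓ : ℝ)⁻¹) ^ j * ((ℓ : ℝ)⁻¹) ^ j := by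
    refine IsUltrametricDist.norm_tsum_le_of_forall_le_of_nonneg (by positivity) fun d => ?_
    refine (hT j d).trans ?_
    rw [← hρ, ← pow_add, ← pow_mul]
    exact pow_le_pow_of_le_one hρ0.le hρ1.le (by nlinarith [Nat.zero_le d.degree])
  have hf := inv_pow_le_norm_factorial (ℓ := ℓ) j
  have hpos : (0 : ℝ) < ((ℓ : ℝ)⁻¹) ^ j := by positivity
  rw [div_le_iff₀ (hpos.trans_le hf)]
  exact hb.trans (mul_le_mul_of_nonneg_left hf hpos.le)

/-- A set of natural numbers is semilinear with period `M` as soon as its trace on each residue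
class modulo `M` is finite or everything. -/
theorem isSemilinearWithPeriod_of_finite_or_eq_univ {M : ℕ} (hM : 0 < M) (A : Set ℕ)
    (h : ∀ a < M, {n | a + M * n ∈ A}.Finite ∨ {n | a + M * n ∈ A} = Set.univ) :
    IsSemilinearWithPeriod M A := by
  classical
  let T := (Finset.range M).filter fun a => {n | a + M * n ∈ A} = Set.univ
  have hfin : {m | m ∈ A ∧ m % M ∉ T}.Finite := by
    refine ((Set.finite_Iio M).biUnion (t := fun a => (fun n => a + M * n) ''
      (if a ∈ T then ∅ else {n | a + M * n ∈ A})) fun a ha => ?_).subset ?_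
    · refine Set.Finite.image _ ?_
      split_ifs with haT
      · exact Set.finite_empty
      · exact (h a ha).resolve_right fun h' => haT (by simpa [T] using ⟨ha, h'⟩)
    · rintro m ⟨hmA, hmT⟩
      have hm := Nat.mod_add_div m M
      refine Set.mem_biUnion (Nat.mod_lt m hM) ⟨m / M, ?_, hm⟩
      rw [if_neg hmT, Set.mem_ofPred_eq, hm]
      exact hmA
  refine ⟨hfin.toFinset, T, fun a ha => Finset.mem_range.1 (Finset.mem_filter.1 ha).1, ?_⟩
  ext m
  simp only [Set.Finite.mem_toFinset, Set.mem_ofPred_eq]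
  constructor
  · intro hm
    by_cases hmT : m % M ∈ T
    · exact Or.inr ⟨_, hmT, m / M, by rw [mul_comm, Nat.mod_add_div]⟩
    · exact Or.inl ⟨hm, hmT⟩
  · rintro (hm | ⟨a, ha, j, rfl⟩)
    · exact hm.1
    · have := (Set.eq_univ_iff_forall.1 (Finset.mem_filter.1 ha).2) j
      rwa [mul_comm]

end LocalMordellLang

/-! ### Conclusion -/

theorem lemma4p7 (ℓ : ℕ) [Fact ℓ.Prime] (r N : ℕ) (hr : 0 < r) (c : ℝ) (hc0 : 0 < c)
    (hc1 : c < 1) :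
    ∃ M : ℕ, 0 < M ∧
      ∀ (φ : LocalMordellLang.PowerSeriesRing ℓ r N ≃+* LocalMordellLang.PowerSeriesRing ℓ r N)
        (hφ : Continuous φ),
      ∀ z ∈ LocalMordellLang.closedBall ℓ r N c,
      ∀ I : Ideal (MvPowerSeries (Fin N) 𝓞_ℂ_[ℓ]),
        LocalMordellLang.IsSemilinearWithPeriod M
          {m : ℕ | (LocalMordellLang.Point.map φ hφ)^[m] z ∈
            LocalMordellLang.vanishingLocus r I} := by
  open LocalMordellLang in
  obtain ⟨k, hk⟩ := exists_nat_ge c⁻¹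
  have hk0 : (0 : ℝ) < k := (inv_pos.2 hc0).trans_le hk
  have : NeZero k := ⟨fun h => by simp [h] at hk0⟩
  have hℓ1 : (1 : ℝ) < ℓ := by exact_mod_cast (Fact.out : ℓ.Prime).one_lt
  have hℓ0 : (0 : ℝ) < ℓ := zero_lt_one.trans hℓ1
  let ρ : ℝ := (ℓ : ℝ) ^ (-(k : ℝ)⁻¹)
  have hρ0 : 0 < ρ := Real.rpow_pos_of_pos hℓ0 _
  have hρ1 : ρ < 1 := Real.rpow_lt_one_of_one_lt_of_neg hℓ1 (neg_lt_zero.2 (inv_pos.2 hk0))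
  have hρ : ρ ^ k = (ℓ : ℝ)⁻¹ := by
    rw [← Real.rpow_natCast, ← Real.rpow_mul hℓ0.le, neg_mul, inv_mul_cancel₀ hk0.ne',
      Real.rpow_neg_one]
  have hcρ : (ℓ : ℝ) ^ (-c) ≤ ρ :=
    Real.rpow_le_rpow_of_exponent_le hℓ1.le (neg_le_neg (inv_le_of_inv_le₀ hc0 hk))
  have hMpos := automorphismExponent_pos (ℓ := ℓ) (r := r) (N := N) (k := k) (1 + 2 * k)
  refine ⟨_, hMpos, fun φ hφ z hz I => isSemilinearWithPeriod_of_finite_or_eq_univ hMpos _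
    fun a _ => ?_⟩
  set M := automorphismExponent ℓ r N k (1 + 2 * k)
  -- The iterates stay in the ball of radius `ρ`, since `φ^[a] (X i)` keeps weight `1`.
  have hza : ∀ i, ‖((Point.map φ hφ)^[a] z).coord i‖ ≤ ρ := fun i => by
    rw [Point.coord, map_iterate_hom, ← pow_one ρ]
    refine norm_hom_le z hρ0 hρ1.le hρ (fun i => (hz i).trans hcρ) ?_
    induction a with
    | zero => exact X_mem_weightIdeal i
    | succ a ih =>
      rw [Function.iterate_succ_apply']
      exact map_mem_weightIdeal φ hφ (ih (by omega))
  have hkey := finite_or_eq_univ_setOf_kills φ hφ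
    (iterate_automorphismExponent_sub_mem φ hφ (1 + 2 * k)) _ hρ0 hρ1 hρ hza
  have hadd : ∀ n, (Point.map φ hφ)^[M * n] ((Point.map φ hφ)^[a] z) =
      (Point.map φ hφ)^[a + M * n] z := fun n => by
    rw [add_comm, Function.iterate_add_apply]
  simp only [M, hadd] at hkey
  -- A single `f ∈ I` that does not vanish identically along the class already forces finiteness, so
  -- `I` needs no finite generation.
  by_cases hall : ∀ f ∈ I,
      {n : ℕ | ((Point.map φ hφ)^[a + M * n] z).Kills f} = Set.univ
  · right
    exact Set.eq_univ_of_forall fun n f hf => (Set.eq_univ_iff_forall.1 (hall f hf)) n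
  · left
    push Not at hall
    obtain ⟨f, hf, hne⟩ := hall
    exact ((hkey f).resolve_right hne).subset fun n hn => hn f hf
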